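/- Let \(\Omega\) be a set of paths \(\omega\colon\mathbb{R}_{\ge 0}\to\mathbb{Z}_{\ge 0}\) such that (A1) every \(\omega\in\Omega\) is non-decreasing, and (A2) for all time points \(t_1<\dots<t_n\) in \(\mathbb{R}_{\ge 0}\) with \(n\ge 1\) and all integers \(0\le x_1\le\dots\le x_n\) there is an \(\omega\in\Omega\) with \(\omega(t_i)=x_i\) for all \(i\). Write \(X_t(\omega)=\omega(t)\). For a finite (possibly empty) set \(u\subset\mathbb{R}_{\ge 0}\) of time points, let \(\mathscr{X}_u\) be the set of non-decreasing tuples \(x_u=(x_t)_{t\in u}\) in \(\mathbb{Z}_{\ge 0}\), let \((X_u\in B)=\{\omega\in\Omega\colon(\omega(t))_{t\in u}\in B\}\) for \(B\subseteq\mathscr{X}_u\), and let \((X_u=x_u)=(X_u\in\{x_u\})\), which is \(\Omega\) if \(u=\emptyset\). Let \(\mathcal{F}_u\) be the field (algebra of subsets of \(\Omega\)) generated by all events \((X_v\in B)\) with \(v\) a finite set of time points in \(u\cup[\max u,+\infty)\) (of arbitrary time points if \(u=\emptyset\)) and \(B\subseteq\mathscr{X}_v\). Let \[\mathcal{D}=\{(A,\,(X_u=x_u))\colon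 u\subset\mathbb{R}_{\ge 0}\text{ finite},\ A\in\mathcal{F}_u,\ x_u\in\mathscr{X}_u\}.\] A full conditional probability on \(\Omega\) is a real-valued map \(Q(A\mid C)\), defined for all \(A\subseteq\Omega\) and all non-empty \(C\subseteq\Omega\), such that \(Q(A\mid C)\ge 0\); \(Q(A\mid C)=1\) if \(C\subseteq A\); \(Q(A\cup B\mid C)=Q(A\mid C)+Q(B\mid C)\) if \(A\cap B=\emptyset\); and \(Q(A\cap D\mid C)=Q(A\mid D\cap C)\,Q(D\mid C)\) if \(D\cap C\ne\emptyset\). A coherent conditional probability on \(\mathcal{D}\) is a real-valued map on \(\mathcal{D}\) that can be extended to a full conditional probability on \(\Omega\). Below, a "history" \((t,u,x_u,x)\) consists of \(t\in\mathbb{R}_{\ge 0}\), a finite (possibly empty) set \(u\) of time points that are all smaller than \(t\), a tuple \(x_u\in\mathscr{X}_u\), and an integer \(x\ge 0\) with \((x_u,x)\in\mathscr{X}_{u\cup\{t\}}\). A counting process is a coherent conditional probability \(P\) on \(\mathcal{D}\) such that \(P(X_0=0)=P(X_0=0\mid\Omega)=1\) and, for every history \((t,u,x_u,x)\), \[\lim_{\Delta\to0^+}\frac{P(X_{t+\Delta}\ge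 x+2\mid X_u=x_u,X_t=x)}{\Delta}=0\] and, if \(t>0\), \[\lim_{\Delta\to0^+}\frac{P(X_t\ge x+2\mid X_u=x_u,X_{t-\Delta}=x)}{\Delta}=0.\] A Poisson process is a counting process \(P\) such that, for every history \((t,u,x_u,x)\), all \(\Delta\in\mathbb{R}_{\ge 0}\) and all integers \(y\ge x\), \[P(X_{t+\Delta}=y\mid X_u=x_u,X_t=x)=P(X_{t+\Delta}=y\mid X_t=x)=P(X_{t+\Delta}=y-x\mid X_t=0)\] and \(P(X_{t+\Delta}=y\mid X_t=x)=P(X_\Delta=y\mid X_0=x)\). Theorem. Let \(P\) be a counting process and let \(\lambda\in\mathbb{R}_{\ge 0}\) be such that, for every history \((t,u,x_u,x)\), \[\lim_{\Delta\to0^+}\frac{P(X_{t+\Delta}=x+1\mid X_u=x_u,X_t=x)}{\Delta}=\lambda\] and, if \(t>0\), \[\lim_{\Delta\to0^+}\frac{P(X_t=x+1\mid X_u=x_u,X_{t-\Delta}=x)}{\Delta}=\lambda.\] Then \(P\) is the Poisson process with rate \(\lambda\). That is, \(P\) is a Poisson process; for every history \((t,u,x_u,x)\), every \(\Delta\in\mathbb{R}_{\ge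 0}\) and every integer \(y\ge 0\), \[P(X_{t+\Delta}=y\mid X_u=x_u,X_t=x)=\begin{cases}e^{-\lambda\Delta}\dfrac{(\lambda\Delta)^{y-x}}{(y-x)!}&\text{if }y\ge x,\\[1ex]0&\text{otherwise;}\end{cases}\tag{1}\] and \(P\) is the only coherent conditional probability on \(\mathcal{D}\) that satisfies both \(P(X_0=0)=1\) and (1). -/

import Mathlib

open Set Filter Topology
open scoped NNReal

namespace CountingProc

noncomputable section

/-! ### Full and coherent conditional probabilities -/

/-- A full conditional probability on `S`: a real-valued map on pairs (event, non-empty event).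
The value of `Q` at an empty conditioning event is never used. -/
structure IsFullCondProb {S : Type*} (Q : Set S → Set S → ℝ) : Prop where
  nonneg : ∀ A C : Set S, C.Nonempty → 0 ≤ Q A C
  eq_one : ∀ A C : Set S, C.Nonempty → C ⊆ A → Q A C = 1
  additive : ∀ A B C : Set S, C.Nonempty → A ∩ B = ∅ → Q (A ∪ B) C = Q A C + Q B C
  bayes : ∀ A C D : Set S, (D ∩ C).Nonempty → Q (A ∩ D) C = Q A (D ∩ C) * Q D C

/-- A real-valued map on a set `D` of pairs (event, non-empty event) is a coherent conditional
probability if it can be extended to a full conditional probability. -/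
def IsCoherent {S : Type*} (D : Set (Set S × Set S)) (P : D → ℝ) : Prop :=
  (∀ d ∈ D, d.2.Nonempty) ∧
    ∃ Q : Set S → Set S → ℝ, IsFullCondProb Q ∧ ∀ d : D, P d = Q d.1.1 d.1.2

/-! ### Counting paths, events and fields -/

/-- The tuples of counts at the time points in `u` that are non-decreasing.  A finite increasing
sequence of time points is the finite set of its terms. -/
def stateTuples (u : Finset ℝ≥0) : Set (u → ℕ) := {x | Monotone x}

/-- The two assumptions on the set `Ω` of paths: every path is non-decreasing, and every
non-decreasing tuple of counts at finitely many time points is attained by some path. -/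
structure IsPathSpace (Ω : Set (ℝ≥0 → ℕ)) : Prop where
  nondecreasing : ∀ ω ∈ Ω, ∀ t Δ : ℝ≥0, ω t ≤ ω (t + Δ)
  exists_path : ∀ u : Finset ℝ≥0, u.Nonempty → ∀ x ∈ stateTuples u,
    ∃ ω ∈ Ω, ∀ t : u, ω t = x t

/-- The finitary event `(X_v ∈ B)`. -/
def finEvent (Ω : Set (ℝ≥0 → ℕ)) (v : Finset ℝ≥0) (B : Set (v → ℕ)) : Set Ω :=
  {ω | (fun t : v => ω.1 t) ∈ B}

/-- The event `(X_u = x_u)`; it is the whole of `Ω` if `u` is empty. -/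
def eqEvent (Ω : Set (ℝ≥0 → ℕ)) (u : Finset ℝ≥0) (x : u → ℕ) : Set Ω :=
  finEvent Ω u {x}

/-- The event `(X_t ∈ B)` for a single time point `t`. -/
def atEvent (Ω : Set (ℝ≥0 → ℕ)) (t : ℝ≥0) (B : Set ℕ) : Set Ω := {ω | ω.1 t ∈ B}

/-- The event `(X_u = x_u, X_t = x)`. -/
def condEvent (Ω : Set (ℝ≥0 → ℕ)) (u : Finset ℝ≥0) (xu : u → ℕ) (t : ℝ≥0) (x : ℕ) : Set Ω :=
  eqEvent Ω u xu ∩ atEvent Ω t {x}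

/-- The field `F_u` generated by the finitary events `(X_v ∈ B)` with
`v ⊆ u ∪ [max u, +∞)`; for empty `u` there is no restriction on `v`. -/
def field (Ω : Set (ℝ≥0 → ℕ)) (u : Finset ℝ≥0) : Set (Set Ω) :=
  MeasureTheory.generateSetAlgebra
    {E | ∃ (v : Finset ℝ≥0) (B : Set (v → ℕ)), B ⊆ stateTuples v ∧
      (∀ t ∈ v, t ∈ u ∨ ∀ s ∈ u, s ≤ t) ∧ E = finEvent Ω v B}

/-- The domain of counting processes: all pairs `(A, X_u = x_u)` with `A` in `F_u`. -/
def domainCP (Ω : Set (ℝ≥0 → ℕ)) : Set (Set Ω × Set Ω) :=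
  {d | ∃ (u : Finset ℝ≥0) (x : u → ℕ), x ∈ stateTuples u ∧ d.1 ∈ field Ω u ∧
    d.2 = eqEvent Ω u x}

open Classical in
/-- The value `P (A | C)`.  It is the value of `P` whenever `(A, C)` is in the domain, and `0` by
convention otherwise. -/
def condProb {Ω : Set (ℝ≥0 → ℕ)} (P : domainCP Ω → ℝ) (A C : Set Ω) : ℝ :=
  if h : (A, C) ∈ domainCP Ω then P ⟨(A, C), h⟩ else 0

/-- `IsHistory u xu t x` says that `u` precedes `t`, and that `(x_u, x)` is a non-decreasing tuple
of counts at the time points in `u ∪ t`. -/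
def IsHistory (u : Finset ℝ≥0) (xu : u → ℕ) (t : ℝ≥0) (x : ℕ) : Prop :=
  (∀ s ∈ u, s < t) ∧ xu ∈ stateTuples u ∧ ∀ s : u, xu s ≤ x

/-- For `u` before `t`, a pair `(X_s ∈ B | X_u = x_u, X_t = x)` with `t ≤ s` is in the domain, so
that `condProb` is the value of `P` there. -/
theorem mem_domainCP {Ω : Set (ℝ≥0 → ℕ)} {u : Finset ℝ≥0}
    {xu : u → ℕ} {t s : ℝ≥0} {x : ℕ} (h : IsHistory u xu t x) (hs : t ≤ s) (B : Set ℕ) :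
    (atEvent Ω s B, condEvent Ω u xu t x) ∈ domainCP Ω := by
  classical
  obtain ⟨hu, hm, hx⟩ := h
  refine ⟨insert t u, fun r => if hr : r.1 ∈ u then xu ⟨r.1, hr⟩ else x, ?_, ?_, ?_⟩
  · rintro ⟨a, ha⟩ ⟨b, hb⟩ hab
    have hab' : a ≤ b := hab
    by_cases h1 : a ∈ u <;> by_cases h2 : b ∈ u <;> simp only [h1, h2, dite_true, dite_false]
    · exact hm hab'
    · exact hx _
    · rcases Finset.mem_insert.1 ha with rfl | h
      · exact absurd (hu b h2) (not_lt.2 hab')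
      · exact absurd h h1
    · exact le_rfl
  · refine MeasureTheory.generateSetAlgebra.base _
      ⟨{s}, {y | y ⟨s, Finset.mem_singleton_self s⟩ ∈ B ∧ Monotone y}, fun y hy => hy.2, ?_, ?_⟩
    · intro r hr
      rw [Finset.mem_singleton.1 hr]
      refine Or.inr fun q hq => ?_
      rcases Finset.mem_insert.1 hq with rfl | hq
      · exact hs
      · exact (hu q hq).le.trans hs
    · ext ω
      simp only [atEvent, finEvent, mem_ofPred_eq]
      refine ⟨fun hB => ⟨hB, fun a b _ => ?_⟩, fun hB => hB.1⟩
      rw [Subsingleton.elim a b]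
  · ext ω
    simp only [condEvent, eqEvent, finEvent, atEvent, mem_inter_iff, mem_ofPred_eq,
      mem_singleton_iff]
    have htu : t ∉ u := fun h => lt_irrefl t (hu t h)
    constructor
    · rintro ⟨h1, h2⟩
      funext ⟨a, ha⟩
      by_cases h : a ∈ u
      · simpa [h] using congrFun h1 ⟨a, h⟩
      · rcases Finset.mem_insert.1 ha with rfl | h'
        · simpa [h] using h2
        · exact absurd h' h
    · intro h
      refine ⟨funext fun ⟨a, ha⟩ => ?_, ?_⟩
      · simpa [ha] using congrFun h ⟨a, Finset.mem_insert_of_mem ha⟩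
      · simpa [htu] using congrFun h ⟨t, Finset.mem_insert_self t u⟩

/-! ### Counting processes and Poisson processes -/

/-- `P (X_0 = 0) = 1`, where conditioning on the sure event is omitted. -/
def StartsAtZero {Ω : Set (ℝ≥0 → ℕ)} (P : domainCP Ω → ℝ) : Prop :=
  condProb P (atEvent Ω 0 {0}) univ = 1

/-- A counting process: a coherent conditional probability on the domain that starts at zero and is
orderly.  In the limits from the left only small `Δ` matter, for which `t - Δ` is a
genuine difference and lies after `u`. -/
structure IsCountingProcess {Ω : Set (ℝ≥0 → ℕ)} (P : domainCP Ω → ℝ) : Prop where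
  coherent : IsCoherent (domainCP Ω) P
  start : StartsAtZero P
  orderly_right : ∀ (t : ℝ≥0) (u : Finset ℝ≥0) (xu : u → ℕ) (x : ℕ), IsHistory u xu t x →
    Tendsto (fun Δ : ℝ≥0 =>
        condProb P (atEvent Ω (t + Δ) (Ici (x + 2))) (condEvent Ω u xu t x) / (Δ : ℝ))
      (𝓝[>] 0) (𝓝 0)
  orderly_left : ∀ (t : ℝ≥0) (u : Finset ℝ≥0) (xu : u → ℕ) (x : ℕ), IsHistory u xu t x → 0 < t →
    Tendsto (fun Δ : ℝ≥0 =>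
        condProb P (atEvent Ω t (Ici (x + 2))) (condEvent Ω u xu (t - Δ) x) / (Δ : ℝ))
      (𝓝[>] 0) (𝓝 0)

/-- A Poisson process: a counting process that is Markovian, state-homogeneous and
time-homogeneous.  The event `(X_t = x)` is the event `(X_∅ = x_∅, X_t = x)`. -/
structure IsPoissonProcess {Ω : Set (ℝ≥0 → ℕ)} (P : domainCP Ω → ℝ) : Prop where
  counting : IsCountingProcess P
  markov : ∀ (t Δ : ℝ≥0) (u : Finset ℝ≥0) (xu : u → ℕ) (x y : ℕ), IsHistory u xu t x → x ≤ y →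
    condProb P (atEvent Ω (t + Δ) {y}) (condEvent Ω u xu t x) =
      condProb P (atEvent Ω (t + Δ) {y}) (atEvent Ω t {x})
  state_homogeneous : ∀ (t Δ : ℝ≥0) (x y : ℕ), x ≤ y →
    condProb P (atEvent Ω (t + Δ) {y}) (atEvent Ω t {x}) =
      condProb P (atEvent Ω (t + Δ) {y - x}) (atEvent Ω t {0})
  time_homogeneous : ∀ (t Δ : ℝ≥0) (x y : ℕ), x ≤ y →
    condProb P (atEvent Ω (t + Δ) {y}) (atEvent Ω t {x}) =
      condProb P (atEvent Ω Δ {y}) (atEvent Ω 0 {x})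

/-- The Poisson probability `ψ_r(k) = e^{-r} r^k / k!`. -/
def poissonProb (r : ℝ≥0) (k : ℕ) : ℝ := Real.exp (-(r : ℝ)) * (r : ℝ) ^ k / (k.factorial : ℝ)

/-- The transition probabilities are Poisson distributed with rate `lam`. -/
def HasPoissonTransitions {Ω : Set (ℝ≥0 → ℕ)} (P : domainCP Ω → ℝ) (lam : ℝ≥0) : Prop :=
  ∀ (t Δ : ℝ≥0) (u : Finset ℝ≥0) (xu : u → ℕ) (x y : ℕ), IsHistory u xu t x →
    condProb P (atEvent Ω (t + Δ) {y}) (condEvent Ω u xu t x) =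
      if x ≤ y then poissonProb (lam * Δ) (y - x) else 0

/-- `P` is the Poisson process with rate `lam`: a Poisson process with Poisson distributed
transition probabilities, and the only coherent conditional probability on the domain that starts
at zero and has these transition probabilities. -/
structure IsThePoissonProcess {Ω : Set (ℝ≥0 → ℕ)} (P : domainCP Ω → ℝ) (lam : ℝ≥0) : Prop where
  poisson : IsPoissonProcess P
  transitions : HasPoissonTransitions P lam
  unique : ∀ P' : domainCP Ω → ℝ, IsCoherent (domainCP Ω) P' → StartsAtZero P' →
    HasPoissonTransitions P' lam → P' = P

end

end CountingProc

/-!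
A full conditional probability `Q` extending `P` satisfies the law of total probability over
finitely many values of a count.  Paths are non-decreasing, so `X_s' = y` forces `X_s ≤ y` for
`s ≤ s'`, and finite additivity suffices to write the increment of `s ↦ Q (X_s = y | C)` between
`s` and `s'` as a finite sum over the states `j ≤ y` at time `s` (`increment_eq_sum`).  Orderliness
and the given rates provide the limits of the coefficients divided by the elapsed time
(`IsFullCondProb.tendsto_jumpRate`).

For an event `C` that fixes the path at finitely many time points up to `t`, the limits from the
right thus yield the forward equations `p_y' = λ (p_{y-1} - p_y)` for `p_y (s) = Q (X_{t+s} = y | C)`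
with derivatives from the right (`tendsto_forward`), and the limits from the left yield continuity
from the left (`tendsto_left`).  A continuous function whose right derivative vanishes is constant,
so these equations have only the Poisson solution (`poisson_of_forward_equations`,
`transition_eq_poisson`).

For uniqueness, every event of the field `F_u` depends on the path at finitely many time points only
(`exists_determinedAt`).  Two extensions with the same transition probabilities agree on such events
by induction on the number of time points after `u`: one splits according to the value at the
first of them.  There are infinitely many values, and `Q` is only finitely additive, but the
Poisson probabilities sum to one, so the values beyond a large bound contribute arbitrarily little
(`eq_of_transitions_eq`).
-/

namespace CountingProc

/-! ### Full conditional probabilities -/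

namespace IsFullCondProb

variable {S : Type*} {Q : Set S → Set S → ℝ}

/-- Only the part of an event inside the conditioning event matters. -/
theorem congr (hQ : IsFullCondProb Q) {A B C : Set S} (hC : C.Nonempty) (h : A ∩ C = B ∩ C) :
    Q A C = Q B C := by
  have key (A : Set S) : Q A C = Q (A ∩ C) C := by
    have h1 := hQ.bayes A C C (by simpa using hC)
    rw [inter_self, hQ.eq_one C C hC subset_rfl, mul_one] at h1
    exact h1.symm
  rw [key A, key B, h]

theorem eq_zero (hQ : IsFullCondProb Q) {A C : Set S} (hC : C.Nonempty) (h : A ∩ C = ∅) :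
    Q A C = 0 := by
  have h1 := hQ.additive ∅ ∅ C hC (by simp)
  rw [hQ.congr (B := ∅) hC (by simpa using h)]
  simp only [union_self] at h1
  linarith

theorem compl (hQ : IsFullCondProb Q) (A : Set S) {C : Set S} (hC : C.Nonempty) :
    Q Aᶜ C = 1 - Q A C := by
  have h1 := hQ.additive A Aᶜ C hC (by simp)
  rw [union_compl_self, hQ.eq_one univ C hC (subset_univ _)] at h1
  linarith

theorem mono (hQ : IsFullCondProb Q) {A B C : Set S} (hC : C.Nonempty) (h : A ⊆ B) :
    Q A C ≤ Q B C := by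
  have h1 := hQ.additive A (B \ A) C hC (by simp)
  rw [union_sdiff_cancel h] at h1
  linarith [hQ.nonneg (B \ A) C hC]

theorem le_one (hQ : IsFullCondProb Q) (A : Set S) {C : Set S} (hC : C.Nonempty) :
    Q A C ≤ 1 := by
  rw [← hQ.eq_one univ C hC (subset_univ _)]
  exact hQ.mono hC (subset_univ _)

/-- The multiplication rule, which needs no condition on `D`: if `D` misses `C`, both sides
vanish. -/
theorem inter_eq (hQ : IsFullCondProb Q) (A D : Set S) {C : Set S} (hC : C.Nonempty) :
    Q (A ∩ D) C = Q A (D ∩ C) * Q D C := by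
  by_cases h : (D ∩ C).Nonempty
  · exact hQ.bayes A C D h
  · rw [not_nonempty_iff_eq_empty] at h
    rw [hQ.eq_zero hC h, mul_zero, hQ.eq_zero hC]
    rw [inter_assoc, h, inter_empty]

/-- The law of total probability over finitely many values of a random variable. -/
theorem inter_preimage_eq_sum (hQ : IsFullCondProb Q) (X : S → ℕ) (s : Finset ℕ) (A : Set S)
    {C : Set S} (hC : C.Nonempty) :
    Q (A ∩ X ⁻¹' s) C = ∑ j ∈ s, Q A (X ⁻¹' {j} ∩ C) * Q (X ⁻¹' {j}) C := by
  classical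
  induction s using Finset.induction_on with
  | empty => simp [hQ.eq_zero hC]
  | insert j s hj ih =>
    rw [Finset.sum_insert hj, ← ih, ← hQ.inter_eq A _ hC, ← hQ.additive _ _ _ hC]
    · rw [← inter_union_distrib_left, ← preimage_union, Finset.coe_insert, insert_eq]
    · ext ω
      simp only [mem_inter_iff, mem_preimage, mem_singleton_iff, Finset.mem_coe,
        mem_empty_iff_false, iff_false]
      rintro ⟨⟨_, rfl⟩, _, h⟩
      exact hj h

end IsFullCondProb

/-- The entry `(j, y)` of the generator of the Poisson process: the rate of the jumps from `j`
to `y`, or minus the total rate of the jumps away from `j` if `y = j`. -/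
def jumpRate (lam : ℝ) (j y : ℕ) : ℝ := if y = j then -lam else if y = j + 1 then lam else 0

theorem sum_jumpRate_zero (lam : ℝ) (p : ℕ → ℝ) :
    ∑ j ∈ Finset.range (0 + 1), jumpRate lam j 0 * p j = -lam * p 0 := by
  simp [jumpRate]

theorem sum_jumpRate_succ (lam : ℝ) (p : ℕ → ℝ) (k : ℕ) :
    ∑ j ∈ Finset.range (k + 1 + 1), jumpRate lam j (k + 1) * p j
      = lam * p k - lam * p (k + 1) := by
  rw [Finset.sum_range_succ, Finset.sum_range_succ, Finset.sum_eq_zero]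
  · simp [jumpRate]; ring
  · intro j hj
    rw [Finset.mem_range] at hj
    rw [jumpRate, if_neg (by omega), if_neg (by omega), zero_mul]

/-- The rates of single and of multiple jumps determine the rates of all transitions.  The
conditioning event `E Δ`, and not only the count `X Δ`, may depend on `Δ`, so that the lemma covers
increments both after and before a fixed time point. -/
theorem IsFullCondProb.tendsto_jumpRate {S : Type*} {Q : Set S → Set S → ℝ}
    (hQ : IsFullCondProb Q) {F : Filter ℝ≥0} {X : ℝ≥0 → S → ℕ} {E : ℝ≥0 → Set S} {j y : ℕ}
    {lam : ℝ} (hE : ∀ᶠ Δ in F, (E Δ).Nonempty ∧ ∀ ω ∈ E Δ, j ≤ X Δ ω) (hjy : j ≤ y)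
    (h1 : Tendsto (fun Δ : ℝ≥0 => Q (X Δ ⁻¹' {j + 1}) (E Δ) / (Δ : ℝ)) F (𝓝 lam))
    (h2 : Tendsto (fun Δ : ℝ≥0 => Q (X Δ ⁻¹' Ici (j + 2)) (E Δ) / (Δ : ℝ)) F (𝓝 0)) :
    Tendsto (fun Δ : ℝ≥0 => (Q (X Δ ⁻¹' {y}) (E Δ) - if y = j then 1 else 0) / (Δ : ℝ)) F
      (𝓝 (jumpRate lam j y)) := by
  rcases eq_or_ne y j with rfl | hy
  · simp only [jumpRate, if_true]
    have h3 := (h1.add h2).neg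
    rw [add_zero] at h3
    refine h3.congr' ?_
    filter_upwards [hE] with Δ ⟨hne, hle⟩
    have h4 := hQ.additive (X Δ ⁻¹' {y + 1}) (X Δ ⁻¹' Ici (y + 2)) (E Δ) hne (by
      rw [← preimage_inter]
      convert preimage_empty
      ext k
      simp only [mem_inter_iff, mem_singleton_iff, mem_Ici, mem_empty_iff_false, iff_false]
      omega)
    have h5 : Q (X Δ ⁻¹' {y + 1} ∪ X Δ ⁻¹' Ici (y + 2)) (E Δ) = 1 - Q (X Δ ⁻¹' {y}) (E Δ) := by
      rw [← hQ.compl _ hne]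
      refine hQ.congr hne ?_
      ext ω
      simp only [mem_inter_iff, mem_union, mem_preimage, mem_singleton_iff, mem_Ici, mem_compl_iff]
      refine and_congr_left fun hω => ?_
      have := hle ω hω
      omega
    rw [← add_div, ← h4, h5]
    ring
  · simp only [jumpRate, if_neg hy, sub_zero]
    rcases eq_or_ne y (j + 1) with rfl | hy'
    · simpa using h1
    · rw [if_neg hy']
      refine squeeze_zero' ?_ ?_ h2
      · filter_upwards [hE] with Δ hΔ
        exact div_nonneg (hQ.nonneg _ _ hΔ.1) Δ.2
      · filter_upwards [hE] with Δ hΔ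
        refine div_le_div_of_nonneg_right (hQ.mono hΔ.1 (preimage_mono ?_)) Δ.2
        rw [singleton_subset_iff, mem_Ici]
        omega

/-! ### The forward equations -/

theorem hasDerivAt_poisson_zero (lam s : ℝ) :
    HasDerivAt (fun s : ℝ => Real.exp (-(lam * s)) * (lam * s) ^ 0 / (Nat.factorial 0 : ℝ))
      (-lam * (Real.exp (-(lam * s)) * (lam * s) ^ 0 / (Nat.factorial 0 : ℝ))) s := by
  have h0 : HasDerivAt (fun s : ℝ => lam * s) lam s := by
    simpa using (hasDerivAt_id s).const_mul lam
  simp only [pow_zero, Nat.factorial_zero, Nat.cast_one, div_one, mul_one]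
  refine h0.neg.exp.congr_deriv ?_
  simp only [Pi.neg_apply]
  ring

theorem hasDerivAt_poisson_succ (lam s : ℝ) (n : ℕ) :
    HasDerivAt
      (fun s : ℝ => Real.exp (-(lam * s)) * (lam * s) ^ (n + 1) / ((n + 1).factorial : ℝ))
      (lam * (Real.exp (-(lam * s)) * (lam * s) ^ n / (n.factorial : ℝ))
        - lam * (Real.exp (-(lam * s)) * (lam * s) ^ (n + 1) / ((n + 1).factorial : ℝ))) s := by
  have h0 : HasDerivAt (fun s : ℝ => lam * s) lam s := by
    simpa using (hasDerivAt_id s).const_mul lam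
  have h := ((h0.neg.exp).mul (h0.pow (n + 1))).div_const ((n + 1).factorial : ℝ)
  refine h.congr_deriv ?_
  have h1 : (n.factorial : ℝ) ≠ 0 := by positivity
  have h2 : (n : ℝ) + 1 ≠ 0 := by positivity
  simp only [Nat.factorial_succ, Nat.cast_mul, Nat.cast_add, Nat.cast_one, Nat.add_sub_cancel,
    Pi.pow_apply, Pi.neg_apply]
  field_simp
  ring

/-- If `f' = -λ f + b` holds for two continuous functions with the same initial value, in the sense
of right derivatives, then they agree: `exp (λ s)` times their difference has right derivative
zero. -/
theorem eq_of_hasDerivWithinAt_linear {f g b : ℝ → ℝ} {lam : ℝ} (h0 : f 0 = g 0)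
    (hfc : ContinuousOn f (Ici 0)) (hgc : ContinuousOn g (Ici 0))
    (hf : ∀ s, 0 ≤ s → HasDerivWithinAt f (b s - lam * f s) (Ici s) s)
    (hg : ∀ s, 0 ≤ s → HasDerivWithinAt g (b s - lam * g s) (Ici s) s) :
    ∀ s, 0 ≤ s → f s = g s := by
  intro s hs
  have h := constant_of_has_deriv_right_zero (f := fun r => Real.exp (lam * r) * (f r - g r))
    (a := 0) (b := s) ?_ ?_ s ⟨hs, le_rfl⟩
  · simp only [h0, sub_self, mul_zero] at h
    have := (mul_eq_zero.1 h).resolve_left (Real.exp_ne_zero _)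
    linarith
  · refine ContinuousOn.mul (by fun_prop) ((hfc.sub hgc).mono Icc_subset_Ici_self)
  · intro r hr
    have he : HasDerivWithinAt (fun r => Real.exp (lam * r)) (Real.exp (lam * r) * lam)
        (Ici r) r := by
      simpa using (((hasDerivAt_id r).const_mul lam).exp).hasDerivWithinAt
    refine (he.mul ((hf r hr.1).sub (hg r hr.1))).congr_deriv ?_
    simp only [Pi.sub_apply]
    ring

/-- The Poisson probabilities are the only solution of the forward equations that starts with
unit mass at `x`.  Continuity and derivatives from the right suffice. -/
theorem poisson_of_forward_equations {p : ℕ → ℝ → ℝ} {lam : ℝ} {x : ℕ}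
    (h0 : ∀ y, p y 0 = if y = x then 1 else 0)
    (hc : ∀ y, ContinuousOn (p y) (Ici 0))
    (hd : ∀ y s, 0 ≤ s → HasDerivWithinAt (p y)
      (∑ j ∈ Finset.range (y + 1), jumpRate lam j y * p j s) (Ici s) s) (y : ℕ) :
    ∀ s, 0 ≤ s → p y s = if x ≤ y then
      Real.exp (-(lam * s)) * (lam * s) ^ (y - x) / ((y - x).factorial : ℝ) else 0 := by
  set g : ℕ → ℝ → ℝ := fun y s => if x ≤ y then
      Real.exp (-(lam * s)) * (lam * s) ^ (y - x) / ((y - x).factorial : ℝ) else 0 with hg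
  have hg0 : ∀ y, p y 0 = g y 0 := by
    intro y
    rw [h0, hg]
    rcases lt_trichotomy y x with h | rfl | h
    · simp [h.ne, h]
    · simp
    · simp [h.ne', h.le, Nat.sub_ne_zero_of_lt h]
  have hgc : ∀ y, ContinuousOn (g y) (Ici 0) := by
    intro y
    by_cases h : x ≤ y <;> simp only [hg, h, if_true, if_false] <;> fun_prop
  have hgd : ∀ k s, HasDerivAt (g (k + 1)) (lam * g k s - lam * g (k + 1) s) s := by
    intro k s
    simp only [hg]
    rcases lt_trichotomy (k + 1) x with h | rfl | h
    · simp only [not_le.2 h, show ¬ x ≤ k by omega, if_false]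
      simpa using hasDerivAt_const s (0 : ℝ)
    · simp only [le_refl, if_true, show ¬ k + 1 ≤ k by omega, if_false, Nat.sub_self]
      refine (hasDerivAt_poisson_zero lam s).congr_deriv (by ring)
    · obtain ⟨n, rfl⟩ := Nat.exists_eq_add_of_le (Nat.le_of_lt_succ h)
      simp only [show x ≤ x + n by omega, show x ≤ x + n + 1 by omega, if_true,
        show x + n + 1 - x = n + 1 by omega, Nat.add_sub_cancel_left]
      exact hasDerivAt_poisson_succ lam s n
  have hgd0 : ∀ s, HasDerivAt (g 0) (-lam * g 0 s) s := by
    intro s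
    simp only [hg]
    rcases Nat.eq_zero_or_pos x with rfl | h
    · simpa using hasDerivAt_poisson_zero lam s
    · simp only [not_le.2 h, if_false]
      simpa using hasDerivAt_const s (0 : ℝ)
  induction y with
  | zero =>
    refine eq_of_hasDerivWithinAt_linear (b := fun _ => 0) (lam := lam) (hg0 0) (hc 0) (hgc 0)
      (fun s hs => ?_) (fun s hs => ?_)
    · refine (hd 0 s hs).congr_deriv ?_
      rw [sum_jumpRate_zero lam (fun j => p j s)]; ring
    · exact (hgd0 s).hasDerivWithinAt.congr_deriv (by ring)
  | succ k ih =>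
    refine eq_of_hasDerivWithinAt_linear (b := fun s => lam * g k s) (lam := lam) (hg0 _) (hc _)
      (hgc _) (fun s hs => ?_) (fun s hs => (hgd k s).hasDerivWithinAt)
    refine (hd (k + 1) s hs).congr_deriv ?_
    rw [sum_jumpRate_succ lam (fun j => p j s), ih s hs]

/-! ### Conditioning on the values of a path -/

/-- The event that a path takes the same values as `ω` at the time points in `w`.  Every
conditioning event `(X_u = x_u, X_t = x)` has this form, because it is attained by some path. -/
def agree (Ω : Set (ℝ≥0 → ℕ)) (w : Finset ℝ≥0) (ω : Ω) : Set Ω :=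
  {ω' | ∀ r ∈ w, ω'.1 r = ω.1 r}

variable {Ω : Set (ℝ≥0 → ℕ)}

theorem agree_nonempty (w : Finset ℝ≥0) (ω : Ω) : (agree Ω w ω).Nonempty :=
  ⟨ω, fun _ _ => rfl⟩

theorem IsPathSpace.mono (hΩ : IsPathSpace Ω) (ω : Ω) : Monotone ω.1 := by
  intro a b hab
  obtain ⟨c, rfl⟩ := exists_add_of_le hab
  exact hΩ.nondecreasing ω.1 ω.2 a c

theorem eqEvent_path (w : Finset ℝ≥0) (ω : Ω) :
    eqEvent Ω w (fun s => ω.1 s) = agree Ω w ω := by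
  ext ω'
  simp only [eqEvent, finEvent, agree, mem_ofPred_eq, mem_singleton_iff, funext_iff,
    Subtype.forall]

theorem agree_inter_atEvent (w : Finset ℝ≥0) (t : ℝ≥0) (ω : Ω) :
    agree Ω w ω ∩ atEvent Ω t {ω.1 t} = agree Ω (insert t w) ω := by
  ext ω'
  simp only [agree, atEvent, mem_inter_iff, mem_ofPred_eq, mem_singleton_iff,
    Finset.forall_mem_insert]
  exact and_comm

theorem agree_eq_of_mem {w : Finset ℝ≥0} {ω ω' : Ω} (h : ω' ∈ agree Ω w ω) :
    agree Ω w ω = agree Ω w ω' := by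
  ext ω''
  exact forall₂_congr fun r hr => by rw [h r hr]

theorem condEvent_path (w : Finset ℝ≥0) (t : ℝ≥0) (ω : Ω) :
    condEvent Ω w (fun s => ω.1 s) t (ω.1 t) = agree Ω (insert t w) ω := by
  rw [condEvent, eqEvent_path, agree_inter_atEvent]

theorem IsPathSpace.isHistory (hΩ : IsPathSpace Ω) (ω : Ω) {w : Finset ℝ≥0} {t : ℝ≥0} {j : ℕ}
    (h : ∀ r ∈ w, r < t) (hj : ∀ r ∈ w, ω.1 r ≤ j) : IsHistory w (fun s => ω.1 s) t j :=
  ⟨h, fun _ _ hab => hΩ.mono ω hab, fun s => hj s s.2⟩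

theorem IsPathSpace.isHistory_self (hΩ : IsPathSpace Ω) (ω : Ω) {w : Finset ℝ≥0} {t : ℝ≥0}
    (h : ∀ r ∈ w, r < t) : IsHistory w (fun s => ω.1 s) t (ω.1 t) :=
  hΩ.isHistory ω h fun r hr => hΩ.mono ω (h r hr).le

/-- Every history is the history of some path. -/
theorem IsHistory.exists_path {P : domainCP Ω → ℝ} (hP : IsCoherent (domainCP Ω) P)
    {u : Finset ℝ≥0} {xu : u → ℕ} {t : ℝ≥0} {x : ℕ} (h : IsHistory u xu t x) :
    ∃ ω : Ω, xu = (fun s : u => ω.1 s) ∧ x = ω.1 t := by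
  obtain ⟨ω, h1, h2⟩ := hP.1 _ (mem_domainCP h le_rfl univ)
  exact ⟨ω, (mem_singleton_iff.1 h1).symm, (mem_singleton_iff.1 h2).symm⟩

theorem condProb_eq {P : domainCP Ω → ℝ} {Q : Set Ω → Set Ω → ℝ}
    (hext : ∀ d : domainCP Ω, P d = Q d.1.1 d.1.2) {A C : Set Ω} (h : (A, C) ∈ domainCP Ω) :
    condProb P A C = Q A C := by
  rw [condProb, dif_pos h, hext]

theorem condProb_history_eq {P : domainCP Ω → ℝ} {Q : Set Ω → Set Ω → ℝ}
    (hΩ : IsPathSpace Ω) (hext : ∀ d : domainCP Ω, P d = Q d.1.1 d.1.2) (ω : Ω)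
    {w : Finset ℝ≥0} {t s : ℝ≥0} (hw : ∀ r ∈ w, r < t) (hs : t ≤ s) (B : Set ℕ) :
    condProb P (atEvent Ω s B) (condEvent Ω w (fun r => ω.1 r) t (ω.1 t))
      = Q (atEvent Ω s B) (agree Ω (insert t w) ω) := by
  rw [condProb_eq hext (mem_domainCP (hΩ.isHistory_self ω hw) hs B), condEvent_path]

/-! ### Increments of the transition probabilities -/

theorem increment_eq_sum {Q : Set Ω → Set Ω → ℝ} (hΩ : IsPathSpace Ω) (hQ : IsFullCondProb Q)
    {C : Set Ω} (hC : C.Nonempty) {s s' : ℝ≥0} (hs : s ≤ s') (y : ℕ) :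
    Q (atEvent Ω s' {y}) C - Q (atEvent Ω s {y}) C = ∑ j ∈ Finset.range (y + 1),
      (Q (atEvent Ω s' {y}) (atEvent Ω s {j} ∩ C) - if y = j then 1 else 0)
        * Q (atEvent Ω s {j}) C := by
  have h1 := hQ.inter_preimage_eq_sum (fun ω : Ω => ω.1 s) (Finset.range (y + 1))
    (atEvent Ω s' {y}) hC
  have h2 : atEvent Ω s' {y} ∩ (fun ω : Ω => ω.1 s) ⁻¹' (Finset.range (y + 1) : Finset ℕ)
      = atEvent Ω s' {y} := by
    refine inter_eq_left.2 fun ω hω => ?_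
    have h3 : ω.1 s' = y := hω
    have h4 := hΩ.mono ω hs
    simp only [mem_preimage, Finset.coe_range, mem_Iio]
    omega
  rw [h2] at h1
  simp only [sub_mul, Finset.sum_sub_distrib, ite_mul, one_mul, zero_mul, Finset.sum_ite_eq,
    Finset.self_mem_range_succ, if_true]
  rw [h1]
  rfl

/-- The forward difference quotients of the transition probabilities converge. -/
theorem tendsto_forward {Q : Set Ω → Set Ω → ℝ} (hΩ : IsPathSpace Ω) (hQ : IsFullCondProb Q)
    {lam : ℝ}
    (hR : ∀ (t : ℝ≥0) (w : Finset ℝ≥0) (ω : Ω) (y : ℕ), (∀ r ∈ w, r < t) → ω.1 t ≤ y →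
      Tendsto (fun Δ : ℝ≥0 => (Q (atEvent Ω (t + Δ) {y}) (agree Ω (insert t w) ω)
        - if y = ω.1 t then 1 else 0) / (Δ : ℝ)) (𝓝[>] 0) (𝓝 (jumpRate lam (ω.1 t) y)))
    (w : Finset ℝ≥0) (ω : Ω) {s : ℝ≥0} (hw : ∀ r ∈ w, r ≤ s) (y : ℕ) :
    Tendsto (fun Δ : ℝ≥0 => (Q (atEvent Ω (s + Δ) {y}) (agree Ω w ω)
        - Q (atEvent Ω s {y}) (agree Ω w ω)) / (Δ : ℝ)) (𝓝[>] 0)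
      (𝓝 (∑ j ∈ Finset.range (y + 1), jumpRate lam j y * Q (atEvent Ω s {j}) (agree Ω w ω))) := by
  have hC := agree_nonempty w ω
  simp only [fun Δ : ℝ≥0 => increment_eq_sum hΩ hQ hC (le_self_add : s ≤ s + Δ) y,
    Finset.sum_div]
  refine tendsto_finsetSum _ fun j hj => ?_
  simp only [mul_div_right_comm]
  -- A state that the conditioning event excludes at `s` has probability zero; any other one turns
  -- the conditioning event into a history up to `s`.
  by_cases hne : (atEvent Ω s {j} ∩ agree Ω w ω).Nonempty
  · obtain ⟨ω', h1, h2⟩ := hne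
    have h1 : ω'.1 s = j := h1
    subst h1
    refine Tendsto.mul_const _ ?_
    have hins : insert s w = insert s (w.filter (· < s)) := by
      ext r
      simp only [Finset.mem_insert, Finset.mem_filter]
      constructor
      · rintro (h | h)
        · exact Or.inl h
        · exact (hw r h).eq_or_lt.imp_right fun h' => ⟨h, h'⟩
      · exact Or.imp_right And.left
    rw [agree_eq_of_mem h2, inter_comm, agree_inter_atEvent, hins]
    exact hR s _ ω' y (fun r hr => (Finset.mem_filter.1 hr).2)
      (Nat.le_of_lt_succ (Finset.mem_range.1 hj))
  · rw [hQ.eq_zero hC (not_nonempty_iff_eq_empty.1 hne)]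
    simp

/-- The transition probabilities are continuous from the left.  Of the rates of the jumps between
`s - Δ` and `s`, only their boundedness matters here. -/
theorem tendsto_left {Q : Set Ω → Set Ω → ℝ} (hΩ : IsPathSpace Ω) (hQ : IsFullCondProb Q)
    {lam : ℝ}
    (hL : ∀ (t : ℝ≥0) (w : Finset ℝ≥0) (ω : Ω) (j y : ℕ), (∀ r ∈ w, r < t) → 0 < t →
      (∀ r ∈ w, ω.1 r ≤ j) → j ≤ y →
      Tendsto (fun Δ : ℝ≥0 => (Q (atEvent Ω t {y}) (atEvent Ω (t - Δ) {j} ∩ agree Ω w ω)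
        - if y = j then 1 else 0) / (Δ : ℝ)) (𝓝[>] 0) (𝓝 (jumpRate lam j y)))
    (w : Finset ℝ≥0) (ω : Ω) {t s : ℝ≥0} (ht : t ∈ w) (hw : ∀ r ∈ w, r ≤ t) (hs : t < s) (y : ℕ) :
    Tendsto (fun Δ : ℝ≥0 => Q (atEvent Ω (s - Δ) {y}) (agree Ω w ω)) (𝓝[>] 0)
      (𝓝 (Q (atEvent Ω s {y}) (agree Ω w ω))) := by
  have hC := agree_nonempty w ω
  have hsmall : ∀ᶠ Δ : ℝ≥0 in 𝓝[>] 0, 0 < Δ ∧ Δ < s - t := by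
    filter_upwards [self_mem_nhdsWithin, nhdsWithin_le_nhds (Iio_mem_nhds (tsub_pos_of_lt hs))]
      with Δ h1 h2 using ⟨h1, h2⟩
  suffices h : Tendsto (fun Δ : ℝ≥0 => Q (atEvent Ω s {y}) (agree Ω w ω)
      - Q (atEvent Ω (s - Δ) {y}) (agree Ω w ω)) (𝓝[>] 0) (𝓝 0) by
    have h' := (tendsto_const_nhds (x := Q (atEvent Ω s {y}) (agree Ω w ω))).sub h
    simpa using h'
  simp only [fun Δ : ℝ≥0 => increment_eq_sum hΩ hQ hC (tsub_le_self : s - Δ ≤ s) y]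
  have hzero : ∑ j ∈ Finset.range (y + 1), (0 : ℝ) = 0 := Finset.sum_const_zero
  conv =>
    arg 3
    rw [← hzero]
  refine tendsto_finsetSum _ fun j hj => ?_
  -- States below the count at `t` cannot occur at `s - Δ`, which is after `t` for small `Δ`.
  by_cases hjt : ω.1 t ≤ j
  · have h1 := hL s w ω j y (fun r hr => (hw r hr).trans_lt hs) (bot_le.trans_lt hs)
      (fun r hr => (hΩ.mono ω (hw r hr)).trans hjt) (Nat.le_of_lt_succ (Finset.mem_range.1 hj))
    have h2 : Tendsto (fun Δ : ℝ≥0 => (Δ : ℝ)) (𝓝[>] 0) (𝓝 0) := by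
      have : Tendsto (fun Δ : ℝ≥0 => (Δ : ℝ)) (𝓝 0) (𝓝 ((0 : ℝ≥0) : ℝ)) :=
        NNReal.continuous_coe.tendsto 0
      simpa using this.mono_left nhdsWithin_le_nhds
    have h3 := (h1.mul h2).norm
    rw [mul_zero, norm_zero] at h3
    refine squeeze_zero_norm' ?_ h3
    filter_upwards [hsmall] with Δ ⟨hpos, _⟩
    rw [div_mul_cancel₀ _ (NNReal.coe_ne_zero.2 hpos.ne'), norm_mul]
    refine mul_le_of_le_one_right (norm_nonneg _) ?_
    rw [Real.norm_of_nonneg (hQ.nonneg _ _ hC)]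
    exact hQ.le_one _ hC
  · refine tendsto_const_nhds.congr' ?_
    filter_upwards [hsmall] with Δ ⟨_, hΔ⟩
    rw [hQ.eq_zero hC (A := atEvent Ω (s - Δ) {j}), mul_zero]
    refine eq_empty_of_forall_notMem fun ω' h => hjt ?_
    have h1 : ω'.1 (s - Δ) = j := h.1
    rw [← h.2 t ht, ← h1]
    exact hΩ.mono ω' (lt_tsub_comm.1 hΔ).le

/-- The transition probabilities solve the forward equations, and are therefore Poisson. -/
theorem transition_eq_poisson {Q : Set Ω → Set Ω → ℝ} (hΩ : IsPathSpace Ω) (hQ : IsFullCondProb Q)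
    {lam : ℝ}
    (hR : ∀ (t : ℝ≥0) (w : Finset ℝ≥0) (ω : Ω) (y : ℕ), (∀ r ∈ w, r < t) → ω.1 t ≤ y →
      Tendsto (fun Δ : ℝ≥0 => (Q (atEvent Ω (t + Δ) {y}) (agree Ω (insert t w) ω)
        - if y = ω.1 t then 1 else 0) / (Δ : ℝ)) (𝓝[>] 0) (𝓝 (jumpRate lam (ω.1 t) y)))
    (hL : ∀ (t : ℝ≥0) (w : Finset ℝ≥0) (ω : Ω) (j y : ℕ), (∀ r ∈ w, r < t) → 0 < t →
      (∀ r ∈ w, ω.1 r ≤ j) → j ≤ y →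
      Tendsto (fun Δ : ℝ≥0 => (Q (atEvent Ω t {y}) (atEvent Ω (t - Δ) {j} ∩ agree Ω w ω)
        - if y = j then 1 else 0) / (Δ : ℝ)) (𝓝[>] 0) (𝓝 (jumpRate lam j y)))
    (w : Finset ℝ≥0) (ω : Ω) {t : ℝ≥0} (ht : t ∈ w) (hw : ∀ r ∈ w, r ≤ t) (Δ : ℝ≥0) (y : ℕ) :
    Q (atEvent Ω (t + Δ) {y}) (agree Ω w ω) = if ω.1 t ≤ y then
      Real.exp (-(lam * Δ)) * (lam * Δ) ^ (y - ω.1 t) / ((y - ω.1 t).factorial : ℝ) else 0 := by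
  have hC := agree_nonempty w ω
  set p : ℕ → ℝ → ℝ := fun y s => Q (atEvent Ω (t + s.toNNReal) {y}) (agree Ω w ω) with hp
  have hd : ∀ y s, 0 ≤ s → HasDerivWithinAt (p y)
      (∑ j ∈ Finset.range (y + 1), jumpRate lam j y * p j s) (Ici s) s := by
    intro y s hs
    rw [← hasDerivWithinAt_Ioi_iff_Ici, hasDerivWithinAt_iff_tendsto_slope' self_notMem_Ioi]
    have h1 := tendsto_forward hΩ hQ hR w ω (s := t + s.toNNReal)
      (fun r hr => (hw r hr).trans le_self_add) y
    have h2 : Tendsto (fun r : ℝ => (r - s).toNNReal) (𝓝[>] s) (𝓝[>] 0) := by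
      refine tendsto_nhdsWithin_iff.2 ⟨?_, ?_⟩
      · have : Continuous fun r : ℝ => (r - s).toNNReal := by fun_prop
        simpa using (this.tendsto s).mono_left nhdsWithin_le_nhds
      · filter_upwards [self_mem_nhdsWithin] with r hr
        exact Real.toNNReal_pos.2 (sub_pos.2 hr)
    refine (h1.comp h2).congr' ?_
    filter_upwards [self_mem_nhdsWithin] with r hr
    have hr : s < r := hr
    have h3 : t + s.toNNReal + (r - s).toNNReal = t + r.toNNReal := by
      rw [add_assoc, ← Real.toNNReal_add hs (sub_nonneg.2 hr.le), add_sub_cancel]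
    simp only [Function.comp_apply, hp, slope_def_field, h3,
      Real.coe_toNNReal _ (sub_nonneg.2 hr.le)]
  have hc : ∀ y, ContinuousOn (p y) (Ici 0) := by
    intro y s hs
    have hs : 0 ≤ s := hs
    have hr := (hd y s hs).continuousWithinAt
    rcases hs.eq_or_lt with rfl | hpos
    · exact hr
    have hl : ContinuousWithinAt (p y) (Iic s) s := by
      rw [← continuousWithinAt_Iio_iff_Iic]
      have h1 := tendsto_left hΩ hQ hL w ω ht hw (s := t + s.toNNReal)
        (lt_add_of_pos_right t (Real.toNNReal_pos.2 hpos)) y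
      have h2 : Tendsto (fun r : ℝ => (s - r).toNNReal) (𝓝[<] s) (𝓝[>] 0) := by
        refine tendsto_nhdsWithin_iff.2 ⟨?_, ?_⟩
        · have : Continuous fun r : ℝ => (s - r).toNNReal := by fun_prop
          simpa using (this.tendsto s).mono_left nhdsWithin_le_nhds
        · filter_upwards [self_mem_nhdsWithin] with r hr
          exact Real.toNNReal_pos.2 (sub_pos.2 hr)
      refine (h1.comp h2).congr' ?_
      filter_upwards [self_mem_nhdsWithin, nhdsWithin_le_nhds (Ioi_mem_nhds hpos)] with r hr hr0
      have hr : r < s := hr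
      have hr0 : 0 < r := hr0
      have h3 : t + s.toNNReal - (s - r).toNNReal = t + r.toNNReal := by
        refine tsub_eq_of_eq_add ?_
        rw [add_assoc, ← Real.toNNReal_add hr0.le (sub_nonneg.2 hr.le), add_sub_cancel]
      simp only [Function.comp_apply, hp, h3]
    have := hl.union hr
    rw [Iic_union_Ici] at this
    exact this.mono (subset_univ _)
  have h0 : ∀ y, p y 0 = if y = ω.1 t then 1 else 0 := by
    intro y
    simp only [hp, Real.toNNReal_zero, add_zero]
    split_ifs with h
    · exact hQ.eq_one _ _ hC fun ω' h' => (h' t ht).trans h.symm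
    · refine hQ.eq_zero hC (eq_empty_of_forall_notMem fun ω' h' => h ?_)
      rw [← h'.2 t ht]
      exact (show ω'.1 t = y from h'.1).symm
  have h := poisson_of_forward_equations h0 hc hd y Δ Δ.2
  simpa only [hp, Real.toNNReal_coe] using h

/-! ### Uniqueness -/

/-- Whether the event `A` occurs can be told from the values of the path at the time points
in `w`. -/
def DeterminedAt (A : Set Ω) (w : Finset ℝ≥0) : Prop := ∀ ω ∈ A, agree Ω w ω ⊆ A

theorem DeterminedAt.mono {A : Set Ω} {w w' : Finset ℝ≥0} (h : DeterminedAt A w) (hw : w ⊆ w') :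
    DeterminedAt A w' :=
  fun ω hω _ h' => h ω hω fun r hr => h' r (hw hr)

theorem DeterminedAt.compl {A : Set Ω} {w : Finset ℝ≥0} (h : DeterminedAt A w) :
    DeterminedAt Aᶜ w :=
  fun _ hω ω' h' hA => hω (h ω' hA fun r hr => (h' r hr).symm)

/-- Every event of the field `F_u` is determined at finitely many time points, even though the field
is generated by events at arbitrarily many of them. -/
theorem exists_determinedAt {u : Finset ℝ≥0} {A : Set Ω} (hA : A ∈ field Ω u) :
    ∃ w : Finset ℝ≥0, (∀ r ∈ w, r ∈ u ∨ ∀ s ∈ u, s ≤ r) ∧ DeterminedAt A w := by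
  induction hA with
  | base E hE =>
    obtain ⟨v, B, -, hv, rfl⟩ := hE
    refine ⟨v, hv, fun ω hω ω' h' => ?_⟩
    have h : (fun t : v => ω'.1 t) = fun t : v => ω.1 t := funext fun r => h' r r.2
    change (fun t : v => ω'.1 t) ∈ B
    rw [h]
    exact hω
  | empty => exact ⟨∅, by simp, fun ω hω => hω.elim⟩
  | compl A _ ih =>
    obtain ⟨w, hw, h⟩ := ih
    exact ⟨w, hw, h.compl⟩
  | union A B _ _ ihA ihB =>
    obtain ⟨w, hw, h⟩ := ihA
    obtain ⟨w', hw', h'⟩ := ihB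
    refine ⟨w ∪ w', fun r hr => (Finset.mem_union.1 hr).elim (hw r) (hw' r), ?_⟩
    rintro ω (hω | hω)
    · exact ((h.mono Finset.subset_union_left) ω hω).trans subset_union_left
    · exact ((h'.mono Finset.subset_union_right) ω hω).trans subset_union_right

/-- The error in the law of total probability over a finite part of the values of a random
variable is at most the mass of the other values. -/
theorem IsFullCondProb.sub_sum_mem_Icc {S : Type*} {Q : Set S → Set S → ℝ} (hQ : IsFullCondProb Q)
    (X : S → ℕ) (s : Finset ℕ) (A : Set S) {C : Set S} (hC : C.Nonempty) :
    Q A C - ∑ j ∈ s, Q A (X ⁻¹' {j} ∩ C) * Q (X ⁻¹' {j}) C ∈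
      Icc 0 (1 - ∑ j ∈ s, Q (X ⁻¹' {j}) C) := by
  have h1 : Q (X ⁻¹' s) C = ∑ j ∈ s, Q (X ⁻¹' {j}) C := by
    have h := hQ.inter_preimage_eq_sum X s univ hC
    rw [univ_inter] at h
    rw [h]
    refine Finset.sum_congr rfl fun j _ => ?_
    rw [← hQ.inter_eq _ _ hC, univ_inter]
  rw [← hQ.inter_preimage_eq_sum X s A hC, ← h1, ← hQ.compl _ hC]
  have h2 := hQ.additive (A ∩ X ⁻¹' s) (A ∩ (X ⁻¹' s)ᶜ) C hC (by
    rw [← inter_inter_distrib_left, inter_compl_self, inter_empty])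
  rw [inter_union_compl] at h2
  rw [h2, add_sub_cancel_left]
  exact ⟨hQ.nonneg _ _ hC, hQ.mono hC inter_subset_right⟩

/-- Full conditional probabilities with the same transition probabilities of total mass one agree
on all events at finitely many later time points.  They are only finitely additive; that no mass
escapes to infinity makes up for it. -/
theorem eq_of_transitions_eq {Q Q' : Set Ω → Set Ω → ℝ} (hQ : IsFullCondProb Q)
    (hQ' : IsFullCondProb Q')
    (heq : ∀ (w : Finset ℝ≥0) (ω : Ω) (t s : ℝ≥0) (y : ℕ), t ∈ w → (∀ r ∈ w, r ≤ t) → t < s →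
      Q (atEvent Ω s {y}) (agree Ω w ω) = Q' (atEvent Ω s {y}) (agree Ω w ω))
    (hsum : ∀ (w : Finset ℝ≥0) (ω : Ω) (t s : ℝ≥0), t ∈ w → (∀ r ∈ w, r ≤ t) → t < s →
      HasSum (fun y => Q (atEvent Ω s {y}) (agree Ω w ω)) 1)
    (v : Finset ℝ≥0) : ∀ (w : Finset ℝ≥0) (ω : Ω) (t : ℝ≥0) (A : Set Ω), t ∈ w →
      (∀ r ∈ w, r ≤ t) → (∀ r ∈ v, t < r) → DeterminedAt A (w ∪ v) →
      Q A (agree Ω w ω) = Q' A (agree Ω w ω) := by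
  induction v using Finset.induction_on_min with
  | empty =>
    intro w ω t A _ _ _ hA
    have hC := agree_nonempty w ω
    rw [Finset.union_empty] at hA
    by_cases hω : ω ∈ A
    · rw [hQ.eq_one _ _ hC (hA ω hω), hQ'.eq_one _ _ hC (hA ω hω)]
    · have h : A ∩ agree Ω w ω = ∅ :=
        eq_empty_of_forall_notMem fun ω' h' => hA.compl ω hω h'.2 h'.1
      rw [hQ.eq_zero hC h, hQ'.eq_zero hC h]
  | insert s v hs ih =>
    intro w ω t A ht hw hv hA
    have hC := agree_nonempty w ω
    have hts : t < s := hv s (Finset.mem_insert_self s v)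
    -- Splitting at the first later time point `s` fixes the path at one more time point.
    have hterm : ∀ y, Q A (atEvent Ω s {y} ∩ agree Ω w ω) * Q (atEvent Ω s {y}) (agree Ω w ω)
        = Q' A (atEvent Ω s {y} ∩ agree Ω w ω) * Q' (atEvent Ω s {y}) (agree Ω w ω) := by
      intro y
      by_cases hne : (atEvent Ω s {y} ∩ agree Ω w ω).Nonempty
      · obtain ⟨ω', h1, h2⟩ := hne
        have h1 : ω'.1 s = y := h1
        subst h1
        rw [heq w ω t s _ ht hw hts, agree_eq_of_mem h2, inter_comm, agree_inter_atEvent]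
        congr 1
        refine ih (insert s w) ω' s A (Finset.mem_insert_self s w) ?_ hs ?_
        · intro r hr
          rcases Finset.mem_insert.1 hr with rfl | hr
          · exact le_rfl
          · exact (hw r hr).trans hts.le
        · rwa [Finset.insert_union, ← Finset.union_insert]
      · rw [not_nonempty_iff_eq_empty] at hne
        rw [hQ.eq_zero hC hne, hQ'.eq_zero hC hne, mul_zero, mul_zero]
    have hbound : ∀ n : ℕ, |Q A (agree Ω w ω) - Q' A (agree Ω w ω)|
        ≤ 1 - ∑ y ∈ Finset.range n, Q (atEvent Ω s {y}) (agree Ω w ω) := by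
      intro n
      have h1 := hQ.sub_sum_mem_Icc (fun ω : Ω => ω.1 s) (Finset.range n) A hC
      have h2 := hQ'.sub_sum_mem_Icc (fun ω : Ω => ω.1 s) (Finset.range n) A hC
      change _ - ∑ y ∈ Finset.range n, Q A (atEvent Ω s {y} ∩ agree Ω w ω) *
        Q (atEvent Ω s {y}) (agree Ω w ω) ∈
          Icc 0 (1 - ∑ y ∈ Finset.range n, Q (atEvent Ω s {y}) (agree Ω w ω)) at h1
      change _ - ∑ y ∈ Finset.range n, Q' A (atEvent Ω s {y} ∩ agree Ω w ω) *
        Q' (atEvent Ω s {y}) (agree Ω w ω) ∈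
          Icc 0 (1 - ∑ y ∈ Finset.range n, Q' (atEvent Ω s {y}) (agree Ω w ω)) at h2
      simp only [hterm] at h1
      simp only [← heq w ω t s _ ht hw hts] at h1 h2
      rw [abs_le]
      constructor <;> linarith [h1.1, h1.2, h2.1, h2.2]
    have hlim := ((hsum w ω t s ht hw hts).tendsto_sum_nat).const_sub 1
    rw [sub_self] at hlim
    have h0 := ge_of_tendsto' hlim hbound
    exact sub_eq_zero.1 (abs_nonpos_iff.1 h0)

theorem condProb_atEvent_path_eq {P : domainCP Ω → ℝ} {Q : Set Ω → Set Ω → ℝ} {lam : ℝ≥0}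
    (hΩ : IsPathSpace Ω) (hext : ∀ d : domainCP Ω, P d = Q d.1.1 d.1.2)
    (hT : HasPoissonTransitions P lam) {w : Finset ℝ≥0} {t s : ℝ≥0} (ω : Ω) (ht : t ∈ w)
    (hw : ∀ r ∈ w, r ≤ t) (hs : t ≤ s) (y : ℕ) :
    Q (atEvent Ω s {y}) (agree Ω w ω)
      = if ω.1 t ≤ y then poissonProb (lam * (s - t)) (y - ω.1 t) else 0 := by
  have hlt : ∀ r ∈ w.erase t, r < t := fun r hr =>
    (hw r (Finset.mem_of_mem_erase hr)).lt_of_ne (Finset.ne_of_mem_erase hr)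
  have h := hT t (s - t) (w.erase t) (fun r => ω.1 r) (ω.1 t) y (hΩ.isHistory_self ω hlt)
  rwa [add_tsub_cancel_of_le hs, condProb_history_eq hΩ hext ω hlt hs, Finset.insert_erase ht]
    at h

theorem hasSum_poissonProb_sub (r : ℝ≥0) (x : ℕ) :
    HasSum (fun y => if x ≤ y then poissonProb r (y - x) else 0) 1 := by
  have h := ProbabilityTheory.hasSum_one_poissonMeasure r
  rw [← (add_left_injective x).hasSum_iff]
  · simpa [Function.comp_def, poissonProb] using h
  · intro y hy
    refine if_neg fun hxy => hy ⟨y - x, Nat.sub_add_cancel hxy⟩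

/-- Coherent conditional probabilities with the same Poisson transitions that start at zero are
equal.  If nothing is known about the path, conditioning on `X_0 = 0` changes nothing. -/
theorem eq_of_hasPoissonTransitions (hΩ : IsPathSpace Ω) {P P' : domainCP Ω → ℝ} {lam : ℝ≥0}
    (hP : IsCoherent (domainCP Ω) P) (hP' : IsCoherent (domainCP Ω) P')
    (h0 : StartsAtZero P) (h0' : StartsAtZero P')
    (hT : HasPoissonTransitions P lam) (hT' : HasPoissonTransitions P' lam) : P = P' := by
  obtain ⟨hdom, Q, hQ, hext⟩ := hP
  obtain ⟨-, Q', hQ', hext'⟩ := hP'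
  have main : ∀ (w w' : Finset ℝ≥0) (ω : Ω) (t : ℝ≥0) (A : Set Ω), t ∈ w → (∀ r ∈ w, r ≤ t) →
      (∀ r ∈ w', r ∈ w ∨ t ≤ r) → DeterminedAt A w' →
      Q A (agree Ω w ω) = Q' A (agree Ω w ω) := by
    intro w w' ω t A ht hw hw' hA
    refine eq_of_transitions_eq hQ hQ' ?_ ?_ (w'.filter (t < ·)) w ω t A ht hw
      (fun r hr => (Finset.mem_filter.1 hr).2) (hA.mono fun r hr => ?_)
    · intro w ω t s y ht hw hs
      rw [condProb_atEvent_path_eq hΩ hext hT ω ht hw hs.le,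
        condProb_atEvent_path_eq hΩ hext' hT' ω ht hw hs.le]
    · intro w ω t s ht hw hs
      simp only [condProb_atEvent_path_eq hΩ hext hT ω ht hw hs.le]
      exact hasSum_poissonProb_sub _ _
    · rw [Finset.mem_union, Finset.mem_filter]
      rcases hw' r hr with h | h
      · exact Or.inl h
      · rcases h.eq_or_lt with rfl | h
        · exact Or.inl ht
        · exact Or.inr ⟨hr, h⟩
  funext ⟨⟨A, C⟩, hd⟩
  rw [hext, hext']
  obtain ⟨u, x, -, hA, hC⟩ := id hd
  obtain ⟨ω, hω⟩ := hdom _ hd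
  change Q A C = Q' A C
  change A ∈ field Ω u at hA
  change C = eqEvent Ω u x at hC
  change ω ∈ C at hω
  subst hC
  obtain ⟨w', hw', hAw⟩ := exists_determinedAt hA
  have hx : x = fun s : u => ω.1 s := (mem_singleton_iff.1 hω).symm
  rw [hx, eqEvent_path]
  rcases u.eq_empty_or_nonempty with rfl | hu
  · have huniv : agree Ω ∅ ω = univ := eq_univ_of_forall fun ω' r hr => by simp at hr
    have hone : (univ : Set Ω).Nonempty := ⟨ω, mem_univ ω⟩
    -- Off the domain `condProb` is zero, so a value of one shows that the pair lies in the domain.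
    have hstart : (atEvent Ω 0 {0}, (univ : Set Ω)) ∈ domainCP Ω := by
      by_contra h
      rw [StartsAtZero, condProb, dif_neg h] at h0
      exact zero_ne_one h0
    rw [StartsAtZero, condProb_eq hext hstart] at h0
    rw [StartsAtZero, condProb_eq hext' hstart] at h0'
    have hne : (atEvent Ω 0 {0}).Nonempty := by
      by_contra h
      rw [not_nonempty_iff_eq_empty] at h
      rw [h, hQ.eq_zero hone (empty_inter _)] at h0
      exact zero_ne_one h0
    have hcond : ∀ {R : Set Ω → Set Ω → ℝ}, IsFullCondProb R → R (atEvent Ω 0 {0}) univ = 1 →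
        R A univ = R A (atEvent Ω 0 {0}) := by
      intro R hR h1
      have h2 := hR.inter_eq A (atEvent Ω 0 {0}) hone
      have h3 := hR.additive (A ∩ atEvent Ω 0 {0}) (A ∩ (atEvent Ω 0 {0})ᶜ) univ hone (by
        rw [← inter_inter_distrib_left, inter_compl_self, inter_empty])
      have h4 := hR.mono hone (inter_subset_right : A ∩ (atEvent Ω 0 {0})ᶜ ⊆ _)
      have h5 := hR.nonneg (A ∩ (atEvent Ω 0 {0})ᶜ) univ hone
      rw [hR.compl _ hone, h1] at h4
      rw [h1, mul_one, inter_univ] at h2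
      rw [inter_union_compl] at h3
      linarith
    obtain ⟨ω₀, hω₀⟩ := hne
    have hω₀ : ω₀.1 0 = 0 := hω₀
    have h : atEvent Ω 0 {0} = agree Ω {0} ω₀ := by
      ext ω'
      simp [atEvent, agree, hω₀]
    rw [huniv, hcond hQ h0, hcond hQ' h0', h]
    exact main {0} w' ω₀ 0 A (by simp) (by simp) (fun r _ => Or.inr (zero_le)) hAw
  · exact main u w' ω (u.max' hu) A (u.max'_mem hu) (fun r hr => u.le_max' r hr)
      (fun r hr => (hw' r hr).imp_right fun h => h _ (u.max'_mem hu)) hAw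

/-! ### Characterization of the Poisson process -/

theorem hasPoissonTransitions_of_rates (hΩ : IsPathSpace Ω) {P : domainCP Ω → ℝ}
    (hP : IsCountingProcess P) {lam : ℝ≥0}
    (hright : ∀ (t : ℝ≥0) (u : Finset ℝ≥0) (xu : u → ℕ) (x : ℕ), IsHistory u xu t x →
      Tendsto (fun Δ : ℝ≥0 =>
          condProb P (atEvent Ω (t + Δ) {x + 1}) (condEvent Ω u xu t x) / (Δ : ℝ))
        (𝓝[>] 0) (𝓝 (lam : ℝ)))
    (hleft : ∀ (t : ℝ≥0) (u : Finset ℝ≥0) (xu : u → ℕ) (x : ℕ), IsHistory u xu t x → 0 < t →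
      Tendsto (fun Δ : ℝ≥0 =>
          condProb P (atEvent Ω t {x + 1}) (condEvent Ω u xu (t - Δ) x) / (Δ : ℝ))
        (𝓝[>] 0) (𝓝 (lam : ℝ))) :
    HasPoissonTransitions P lam := by
  obtain ⟨hdom, Q, hQ, hext⟩ := id hP.coherent
  have hR : ∀ (t : ℝ≥0) (w : Finset ℝ≥0) (ω : Ω) (y : ℕ), (∀ r ∈ w, r < t) → ω.1 t ≤ y →
      Tendsto (fun Δ : ℝ≥0 => (Q (atEvent Ω (t + Δ) {y}) (agree Ω (insert t w) ω)
        - if y = ω.1 t then 1 else 0) / (Δ : ℝ)) (𝓝[>] 0) (𝓝 (jumpRate lam (ω.1 t) y)) := by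
    intro t w ω y hw hy
    have hh := hΩ.isHistory_self ω hw
    have h1 := hright t w _ _ hh
    have h2 := hP.orderly_right t w _ _ hh
    simp only [fun Δ B => condProb_history_eq hΩ hext ω hw (le_self_add : t ≤ t + Δ) B] at h1 h2
    refine hQ.tendsto_jumpRate (X := fun Δ ω' => ω'.1 (t + Δ)) (Eventually.of_forall fun Δ =>
      ⟨agree_nonempty _ ω, fun ω' h' => ?_⟩) hy h1 h2
    rw [← h' t (Finset.mem_insert_self t w)]
    exact hΩ.mono ω' le_self_add
  have hL : ∀ (t : ℝ≥0) (w : Finset ℝ≥0) (ω : Ω) (j y : ℕ), (∀ r ∈ w, r < t) → 0 < t →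
      (∀ r ∈ w, ω.1 r ≤ j) → j ≤ y →
      Tendsto (fun Δ : ℝ≥0 => (Q (atEvent Ω t {y}) (atEvent Ω (t - Δ) {j} ∩ agree Ω w ω)
        - if y = j then 1 else 0) / (Δ : ℝ)) (𝓝[>] 0) (𝓝 (jumpRate lam j y)) := by
    intro t w ω j y hw ht hj hy
    have hh := hΩ.isHistory ω hw hj
    -- Only for small `Δ` is `t - Δ` after `w`, so that the pair is in the domain of `P`.
    have hsmall : ∀ᶠ Δ : ℝ≥0 in 𝓝[>] 0, ∀ r ∈ w, r < t - Δ := by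
      refine nhdsWithin_le_nhds ((Finset.eventually_all w).2 fun r hr => ?_)
      filter_upwards [Iio_mem_nhds (tsub_pos_of_lt (hw r hr))] with Δ hΔ
      exact lt_tsub_comm.1 hΔ
    have hcond : ∀ Δ : ℝ≥0, condEvent Ω w (fun r => ω.1 r) (t - Δ) j
        = atEvent Ω (t - Δ) {j} ∩ agree Ω w ω := fun Δ => by
      rw [condEvent, eqEvent_path, inter_comm]
    have htrans : ∀ (B : Set ℕ) (l : ℝ),
        Tendsto (fun Δ : ℝ≥0 => condProb P (atEvent Ω t B)
          (condEvent Ω w (fun r => ω.1 r) (t - Δ) j) / (Δ : ℝ)) (𝓝[>] 0) (𝓝 l) →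
        Tendsto (fun Δ : ℝ≥0 => Q (atEvent Ω t B) (atEvent Ω (t - Δ) {j} ∩ agree Ω w ω)
          / (Δ : ℝ)) (𝓝[>] 0) (𝓝 l) := by
      intro B l h
      refine h.congr' ?_
      filter_upwards [hsmall] with Δ hΔ
      rw [condProb_eq hext (mem_domainCP (hΩ.isHistory ω hΔ hj) tsub_le_self B), hcond]
    refine hQ.tendsto_jumpRate (X := fun _ ω' => ω'.1 t) ?_ hy
      (htrans _ _ (hleft t w _ _ hh ht)) (htrans _ _ (hP.orderly_left t w _ _ hh ht))
    filter_upwards [hsmall] with Δ hΔ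
    refine ⟨?_, fun ω' h' => ?_⟩
    · rw [← hcond]
      exact hdom _ (mem_domainCP (hΩ.isHistory ω hΔ hj) le_rfl univ)
    · have h1 : ω'.1 (t - Δ) = j := h'.1
      rw [← h1]
      exact hΩ.mono ω' tsub_le_self
  intro t Δ u xu x y hh
  obtain ⟨ω, rfl, rfl⟩ := hh.exists_path hP.coherent
  rw [condProb_history_eq hΩ hext ω hh.1 le_self_add,
    transition_eq_poisson hΩ hQ hR hL _ ω (Finset.mem_insert_self t u) _ Δ y]
  · simp only [poissonProb, NNReal.coe_mul]
  · intro r hr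
    rcases Finset.mem_insert.1 hr with rfl | hr
    · exact le_rfl
    · exact (hh.1 r hr).le

/-- Poisson transition probabilities depend only on the elapsed time and on the increment of the
count, so that a counting process with these transitions is a Poisson process. -/
theorem IsCountingProcess.isPoissonProcess {P : domainCP Ω → ℝ} (hP : IsCountingProcess P)
    {lam : ℝ≥0} (hT : HasPoissonTransitions P lam) : IsPoissonProcess P := by
  have hempty : ∀ t Δ x y, x ≤ y → condProb P (atEvent Ω (t + Δ) {y}) (atEvent Ω t {x})
      = poissonProb (lam * Δ) (y - x) := by
    intro t Δ x y hxy
    have hev : condEvent Ω ∅ (fun _ => 0) t x = atEvent Ω t {x} := by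
      refine inter_eq_right.2 fun ω _ => ?_
      exact Subsingleton.elim (α := ((∅ : Finset ℝ≥0) → ℕ)) _ _
    have h := hT t Δ ∅ (fun _ => 0) x y ⟨by simp, fun _ _ _ => le_rfl, fun _ => Nat.zero_le x⟩
    rwa [hev, if_pos hxy] at h
  refine ⟨hP, fun t Δ u xu x y hh hxy => ?_, fun t Δ x y hxy => ?_, fun t Δ x y hxy => ?_⟩
  · rw [hT t Δ u xu x y hh, if_pos hxy, hempty t Δ x y hxy]
  · rw [hempty t Δ x y hxy, hempty t Δ 0 (y - x) (Nat.zero_le _), Nat.sub_zero]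
  · have h := hempty 0 Δ x y hxy
    rw [zero_add] at h
    rw [hempty t Δ x y hxy, h]

end CountingProc

theorem mainTheorem3 (Ω : Set (ℝ≥0 → ℕ)) (hΩ : CountingProc.IsPathSpace Ω)
    (P : CountingProc.domainCP Ω → ℝ) (hP : CountingProc.IsCountingProcess P) (lam : ℝ≥0)
    (hright : ∀ (t : ℝ≥0) (u : Finset ℝ≥0) (xu : u → ℕ) (x : ℕ),
      CountingProc.IsHistory u xu t x →
      Tendsto (fun Δ : ℝ≥0 =>
          CountingProc.condProb P (CountingProc.atEvent Ω (t + Δ) {x + 1})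
            (CountingProc.condEvent Ω u xu t x) / (Δ : ℝ))
        (𝓝[>] 0) (𝓝 (lam : ℝ)))
    (hleft : ∀ (t : ℝ≥0) (u : Finset ℝ≥0) (xu : u → ℕ) (x : ℕ),
      CountingProc.IsHistory u xu t x → 0 < t →
      Tendsto (fun Δ : ℝ≥0 =>
          CountingProc.condProb P (CountingProc.atEvent Ω t {x + 1})
            (CountingProc.condEvent Ω u xu (t - Δ) x) / (Δ : ℝ))
        (𝓝[>] 0) (𝓝 (lam : ℝ))) :
    CountingProc.IsThePoissonProcess P lam := by
  have hT := CountingProc.hasPoissonTransitions_of_rates hΩ hP hright hleft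
  exact ⟨hP.isPoissonProcess hT, hT, fun P' hP' h0' hT' =>
    CountingProc.eq_of_hasPoissonTransitions hΩ hP' hP.coherent h0' hP.start hT' hT⟩
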